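/- Let $n\ge 0$, $N=2^n$, and identify $i\in\mathbb Z_{N}=\{0,\dots,N-1\}$ with its binary expansion $\mathrm{bin}(i)\in\mathbb F_2^n$ (least significant bit first). For $\mathcal I\subseteq\mathbb Z_N$ let $\mathcal C=\{uT_n : u\in\mathbb F_2^N,\ u_i=0 \text{ for } i\notin\mathcal I\}$ be the polar code with information set $\mathcal I$, where $T_n=\begin{bmatrix}1&0\\1&1\end{bmatrix}^{\otimes n}$. A permutation $\pi$ of $\mathbb Z_N$ acts on vectors by $\pi(x)_i=x_{\pi(i)}$. Let $\mathsf{GA}$ be the group of the permutations $\pi_{(A,b)}$ given by $\mathrm{bin}(\pi_{(A,b)}(v))=A\,\mathrm{bin}(v)+b$ with $A\in\mathbb F_2^{n\times n}$ invertible and $b\in\mathbb F_2^n$, and let $\mathcal A=\{\pi\in\mathsf{GA}:\pi(\mathcal C)=\mathcal C\}$. For a profile $S=(s_1,\dots,s_l)$ of positive integers with $s_1+\dots+s_l=n$, let $\mathsf{BLTA}(S)$ be the group of those $\pi_{(A,b)}\in\mathsf{GA}$ for which $A$ is block lower triangular with diagonal blocks of sizes $s_1,\dots,s_l$ (from the upper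 left corner on). Let $\mathrm{SCdec}:\mathbb R^N\to\mathcal C$ be successive cancellation decoding of $\mathcal C$ in the min-approximation, with kernel equations $l^-=\mathrm{sgn}(l_0)\,\mathrm{sgn}(l_1)\min\{|l_0|,|l_1|\}$ and $l^+=(-1)^{w}l_0+l_1$, where $w$ is the re-encoded decision already made on the $l^-$ branch; frozen bits are decided as $0$, and an information bit is decided as $0$ or $1$ according as its final LLR is positive or negative. Call $y\in\mathbb R^N$ tie-free if no information bit has final LLR equal to $0$ when $y$ is decoded, so that the decoding rule determines $\mathrm{SCdec}(y)$. Let $[\mathbb 1]$ be the set of SC-absorbed automorphisms, i.e. of all $\pi\in\mathcal A$ such that $$\pi^{-1}(\mathrm{SCdec}(\pi(y)))=\mathrm{SCdec}(y)\quad\text{for all } y\in\mathbb R^N \text{ such that } y \text{ and } \pi(y) \text{ are tie-free.}$$ **Theorem.** If $\mathcal A=\mathsf{BLTA}(S)$ with $S=(s_1,\dots,s_l)$, then $[\mathbb 1]=\mathsf{BLTA}(S_{\mathbb 1})$ for some profile $$S_{\mathbb 1}=(s_{1,1},\dots,s_{1,j_1},s_{2,1},\dots,s_{2,j_2},\dots,s_{l,1},\dots,s_{l,j_l})$$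 of positive integers with $s_{i,1}+\dots+s_{i,j_i}=s_i$ for every $1\le i\le l$. -/

import Mathlib

namespace PolarSC

open Matrix
open scoped Kronecker

/-- The canonical binary expansion `Z_{2^n} ≃ F_2^n`, least significant bit first. -/
def bin (n : ℕ) : Fin (2 ^ n) ≃ (Fin n → ZMod 2) :=
  (finFunctionFinEquiv : (Fin n → Fin 2) ≃ Fin (2 ^ n)).symm

/-- `half n (a, i) = a * 2 ^ n + i`: the first (`a = 0`) and the second (`a = 1`) half
of the positions `0, …, 2 ^ (n + 1) - 1`. -/
def half (n : ℕ) : Fin 2 × Fin (2 ^ n) ≃ Fin (2 ^ (n + 1)) :=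
  finProdFinEquiv.trans (finCongr (pow_succ' 2 n).symm)

/-! ### Polar codes -/

/-- The kernel `T_2`. -/
def kernel : Matrix (Fin 2) (Fin 2) (ZMod 2) := !![1, 0; 1, 1]

/-- The transformation matrix `T_n = T_2^{⊗ n}`, as `T_{n+1} = T_2 ⊗ T_n`. -/
def transf : (n : ℕ) → Matrix (Fin (2 ^ n)) (Fin (2 ^ n)) (ZMod 2)
  | 0 => 1
  | n + 1 => (kernel ⊗ₖ transf n).reindex (half n) (half n)

/-- The polar code of length `2 ^ n` with information set `I`. -/
def code {n : ℕ} (I : Set (Fin (2 ^ n))) : Set (Fin (2 ^ n) → ZMod 2) :=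
  {x | ∃ u : Fin (2 ^ n) → ZMod 2, (∀ i, i ∉ I → u i = 0) ∧ x = u ᵥ* transf n}

/-! ### Permutations and affine automorphisms -/

/-- The permuted vector `π(x)`, with `π(x)_i = x_{π(i)}`. -/
def permute {N : ℕ} {α : Type*} (π : Equiv.Perm (Fin N)) (x : Fin N → α) : Fin N → α :=
  fun i => x (π i)

/-- `π = π_{(A,b)}`, that is, `π` acts on binary expansions as `v ↦ A v + b`. -/
def IsAffineWith {n : ℕ} (A : Matrix (Fin n) (Fin n) (ZMod 2)) (b : Fin n → ZMod 2)
    (π : Equiv.Perm (Fin (2 ^ n))) : Prop :=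
  ∀ v, bin n (π v) = A *ᵥ bin n v + b

/-- The general affine group, as permutations of `Z_{2^n}`. -/
def GA (n : ℕ) : Set (Equiv.Perm (Fin (2 ^ n))) :=
  {π | ∃ A b, IsUnit A ∧ IsAffineWith A b π}

/-- The block-lower-triangular affine group with profile `S`: the blocks have the sizes
`s_1, s_2, …` from the upper left corner on, and the entry `A i j` vanishes when the block
of the row `i` comes strictly before the block of the column `j`. -/
def BLTA {n : ℕ} (S : Composition n) : Set (Equiv.Perm (Fin (2 ^ n))) :=
  {π | ∃ A b, IsUnit A ∧ (∀ i j, S.index i < S.index j → A i j = 0) ∧ IsAffineWith A b π}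

/-- The affine automorphism group `𝒜 = GA ∩ Aut(C)` of the polar code with information
set `I`. -/
def affineAut {n : ℕ} (I : Set (Fin (2 ^ n))) : Set (Equiv.Perm (Fin (2 ^ n))) :=
  {π | π ∈ GA n ∧ permute π '' code I = code I}

/-! ### Successive cancellation decoding -/

/-- The LLRs entering the decoder of the first half of the input bits (min-approximation
of the boxplus operation). -/
noncomputable def llrMinus {n : ℕ} (y : Fin (2 ^ (n + 1)) → ℝ) : Fin (2 ^ n) → ℝ :=
  fun i => Real.sign (y (half n (0, i))) * Real.sign (y (half n (1, i))) *
    min |y (half n (0, i))| |y (half n (1, i))|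

/-- The LLRs entering the decoder of the second half of the input bits, given the re-encoded
decisions `w` on the first half: `l₀ + l₁` where `w i = 0`, and `-l₀ + l₁` where `w i = 1`. -/
noncomputable def llrPlus {n : ℕ} (w : Fin (2 ^ n) → ZMod 2) (y : Fin (2 ^ (n + 1)) → ℝ) :
    Fin (2 ^ n) → ℝ :=
  fun i => (if w i = 0 then y (half n (0, i)) else -y (half n (0, i))) + y (half n (1, i))

/-- The part of an information set that lies in the first (`a = 0`) or in the second
(`a = 1`) half of the positions. -/
def halfSet {n : ℕ} (a : Fin 2) (I : Set (Fin (2 ^ (n + 1)))) : Set (Fin (2 ^ n)) :=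
  {i | half n (a, i) ∈ I}

open Classical in
/-- The SC decoding function. The input bits `u_0, u_1, …` are decided one after the other;
a frozen bit is `0`, an information bit is `0` or `1` according to the sign of its LLR.
The value is the codeword `u T_n`; for `n + 1` it is `(w + v, v)` with `w` and `v` the
codewords of length `2 ^ n` that encode the first and the second half of `u`. -/
noncomputable def scDec : (n : ℕ) → Set (Fin (2 ^ n)) → (Fin (2 ^ n) → ℝ) →
    (Fin (2 ^ n) → ZMod 2)
  | 0, I, y => fun i => if i ∈ I ∧ y i < 0 then 1 else 0
  | n + 1, I, y =>
    let w := scDec n (halfSet 0 I) (llrMinus y)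
    let v := scDec n (halfSet 1 I) (llrPlus w y)
    fun k => if ((half n).symm k).1 = 0
      then w ((half n).symm k).2 + v ((half n).symm k).2
      else v ((half n).symm k).2

/-- No tie occurs when `y` is SC decoded: the decision LLR of every information bit is
nonzero, so that all the decisions are determined. -/
def NoTie : (n : ℕ) → Set (Fin (2 ^ n)) → (Fin (2 ^ n) → ℝ) → Prop
  | 0, I, y => ∀ i ∈ I, y i ≠ 0
  | n + 1, I, y =>
    NoTie n (halfSet 0 I) (llrMinus y) ∧
      NoTie n (halfSet 1 I) (llrPlus (scDec n (halfSet 0 I) (llrMinus y)) y)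

/-- The automorphism SC decoding function `π⁻¹(SCdec(π(y)))`. -/
noncomputable def aScDec {n : ℕ} (I : Set (Fin (2 ^ n))) (y : Fin (2 ^ n) → ℝ)
    (π : Equiv.Perm (Fin (2 ^ n))) : Fin (2 ^ n) → ZMod 2 :=
  permute π⁻¹ (scDec n I (permute π y))

/-- The set `[𝟙]` of SC-absorbed affine automorphisms. The decoders of `y` and of `π(y)` are
compared wherever both of them are determined, that is, apart from ties. -/
def absorbed {n : ℕ} (I : Set (Fin (2 ^ n))) : Set (Equiv.Perm (Fin (2 ^ n))) :=
  {π | π ∈ affineAut I ∧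
    ∀ y : Fin (2 ^ n) → ℝ, NoTie n I y → NoTie n I (permute π y) → aScDec I y π = scDec n I y}

/-- The profile `S₁` is obtained from `S = (s_1, …, s_l)` by splitting every block `s_i`
into consecutive sub-blocks `s_{i,1}, …, s_{i,j_i}` with sum `s_i`. -/
def Refines {n : ℕ} (S₁ S : Composition n) : Prop :=
  ∃ sub : (i : Fin S.length) → Composition (S.blocksFun i),
    S₁.blocks = (List.ofFn fun i => (sub i).blocks).flatten

end PolarSC

/-!
The absorbed automorphisms form a group that contains every lower triangular affine permutation,
and over `F_2` the only overgroups of the lower unitriangular matrices are the block triangular ones.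

*The absorbed automorphisms form a group.* The composition of two absorbed permutations is compared
at a vector `y` for which an intermediate vector may have a tie. The decoder is locally constant at
every tie-free vector (`NoTie.eventually`), since the boxplus `(|a + b| - |a - b|) / 2` is
continuous. All LLRs of a vector without integer linear relations between its entries are nonzero
integer combinations of these entries, so such generic vectors are tie-free (`IsGeneric.noTie`), as
are all their permutations, and they are dense by Baire's theorem. Hence absorption may be tested
on generic vectors only (`mem_absorbed_iff`), where composition raises no difficulty.

*Triangular permutations are absorbed.* Such a permutation acts on the pairs
`(y_i, y_{i + 2^n})` by a triangular permutation of half the length and swaps the entries of some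
pairs. The swaps do not change `l⁻` and change `l⁺` only by signs. These signs form a codeword of the
second component code, because the permutation preserves the code, and the decoder is equivariant
under sign changes along codewords (`scDec_flipBy`). Induction gives
`IsTriangular.scDec_permute`.

*Overgroups of the unitriangular group.* Let `P` be such a group of matrices and let the cuts be the
`k` for which the span of the last `n - k` coordinate vectors is `P`-invariant. If `k` is not a cut,
conjugation of a lower transvection by a matrix of `P` that moves this span gives a transvection
`1 + x yᵀ` in `P` with `x` and `y` crossing `k`; conjugation by lower matrices and commutators turn it
into the elementary transvection of the entry `(k - 1, k)`. So `P` contains the elementary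
transvections of all entries that the cuts do not force to vanish, and Gaussian elimination with these
shows that `P` is the group of all invertible matrices that respect the cuts
(`IsParabolic.mem_iff`).

The cuts of the absorbed group are the boundaries of the profile `S₁`. They include the boundaries of
`S` because absorbed permutations lie in `BLTA S`, and a composition with more boundaries is a
refinement (`refines_of_boundaries_subset`).
-/

namespace PolarSC

open Matrix Filter Topology
open scoped Kronecker

/-! ### The Plotkin decomposition -/

theorem mem_code_zero {I : Set (Fin (2 ^ 0))} {x : Fin (2 ^ 0) → ZMod 2} :
    x ∈ code I ↔ ∀ i, i ∉ I → x i = 0 := by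
  simp only [code, transf, vecMul_one, Set.mem_ofPred_eq]
  exact ⟨fun ⟨u, hu, hx⟩ => hx ▸ hu, fun h => ⟨x, h, rfl⟩⟩

theorem vecMul_transf_succ {n : ℕ} (u : Fin (2 ^ (n + 1)) → ZMod 2) (a : Fin 2) (i : Fin (2 ^ n)) :
    (u ᵥ* transf (n + 1)) (half n (a, i)) =
      kernel 0 a * ((fun j => u (half n (0, j))) ᵥ* transf n) i +
        kernel 1 a * ((fun j => u (half n (1, j))) ᵥ* transf n) i := by
  simp only [vecMul, dotProduct, transf, reindex_apply, submatrix_apply, Equiv.symm_apply_apply,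
    kroneckerMap_apply]
  rw [← (half n).sum_comp, Fintype.sum_prod_type, Fin.sum_univ_two]
  simp only [Equiv.symm_apply_apply, Finset.mul_sum]
  congr 1 <;> refine Finset.sum_congr rfl fun j _ => by ring

theorem vecMul_transf_succ_zero {n : ℕ} (u : Fin (2 ^ (n + 1)) → ZMod 2) (i : Fin (2 ^ n)) :
    (u ᵥ* transf (n + 1)) (half n (0, i)) =
      ((fun j => u (half n (0, j))) ᵥ* transf n) i +
        ((fun j => u (half n (1, j))) ᵥ* transf n) i := by
  rw [vecMul_transf_succ]; simp [kernel]

theorem vecMul_transf_succ_one {n : ℕ} (u : Fin (2 ^ (n + 1)) → ZMod 2) (i : Fin (2 ^ n)) :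
    (u ᵥ* transf (n + 1)) (half n (1, i)) = ((fun j => u (half n (1, j))) ᵥ* transf n) i := by
  rw [vecMul_transf_succ]; simp [kernel]

theorem eq_of_half {n : ℕ} {α : Type*} {x y : Fin (2 ^ (n + 1)) → α}
    (h0 : ∀ i, x (half n (0, i)) = y (half n (0, i)))
    (h1 : ∀ i, x (half n (1, i)) = y (half n (1, i))) : x = y := by
  funext k
  obtain ⟨⟨a, i⟩, rfl⟩ := (half n).surjective k
  fin_cases a
  · exact h0 i
  · exact h1 i

/-- The Plotkin decomposition of a polar code: its words are the `(w + v, v)` with `w` and `v` in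
the polar codes of the two halves of the information set. -/
theorem mem_code_succ {n : ℕ} {I : Set (Fin (2 ^ (n + 1)))} {x : Fin (2 ^ (n + 1)) → ZMod 2} :
    x ∈ code I ↔ (fun i => x (half n (0, i)) + x (half n (1, i))) ∈ code (halfSet 0 I) ∧
      (fun i => x (half n (1, i))) ∈ code (halfSet 1 I) := by
  constructor
  · rintro ⟨u, hu, rfl⟩
    refine ⟨⟨_, fun i hi => hu (half n (0, i)) hi, funext fun i => ?_⟩,
      ⟨_, fun i hi => hu (half n (1, i)) hi, funext fun i => ?_⟩⟩
    · rw [vecMul_transf_succ_zero, vecMul_transf_succ_one, add_assoc, CharTwo.add_self_eq_zero,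
        add_zero]
    · rw [vecMul_transf_succ_one]
  · rintro ⟨⟨u₀, h₀, e₀⟩, ⟨u₁, h₁, e₁⟩⟩
    refine ⟨fun k => if ((half n).symm k).1 = 0 then u₀ ((half n).symm k).2
      else u₁ ((half n).symm k).2, fun k hk => ?_, eq_of_half (fun i => ?_) fun i => ?_⟩
    · obtain ⟨⟨a, i⟩, rfl⟩ := (half n).surjective k
      fin_cases a
      · simpa using h₀ i hk
      · simpa using h₁ i hk
    · rw [vecMul_transf_succ_zero]
      simp only [Equiv.symm_apply_apply, if_true, one_ne_zero, if_false]
      rw [← e₀, ← e₁, add_assoc, CharTwo.add_self_eq_zero, add_zero]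
    · rw [vecMul_transf_succ_one]
      simp only [Equiv.symm_apply_apply, one_ne_zero, if_false]
      rw [← e₁]

/-! ### Sign symmetry of the decoder -/

@[simp] theorem scDec_succ_zero {n : ℕ} (I : Set (Fin (2 ^ (n + 1)))) (y : Fin (2 ^ (n + 1)) → ℝ)
    (i : Fin (2 ^ n)) :
    scDec (n + 1) I y (half n (0, i)) = scDec n (halfSet 0 I) (llrMinus y) i +
      scDec n (halfSet 1 I) (llrPlus (scDec n (halfSet 0 I) (llrMinus y)) y) i := by
  simp [scDec]

@[simp] theorem scDec_succ_one {n : ℕ} (I : Set (Fin (2 ^ (n + 1)))) (y : Fin (2 ^ (n + 1)) → ℝ)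
    (i : Fin (2 ^ n)) :
    scDec (n + 1) I y (half n (1, i)) =
      scDec n (halfSet 1 I) (llrPlus (scDec n (halfSet 0 I) (llrMinus y)) y) i := by
  simp [scDec]

theorem scDec_mem_code {n : ℕ} (I : Set (Fin (2 ^ n))) (y : Fin (2 ^ n) → ℝ) :
    scDec n I y ∈ code I := by
  induction n with
  | zero => exact mem_code_zero.2 fun i hi => by simp [scDec, hi]
  | succ n ih =>
    refine mem_code_succ.2 ⟨?_, ?_⟩
    · convert ih (halfSet 0 I) (llrMinus y) using 1
      funext i
      rw [scDec_succ_zero, scDec_succ_one, add_assoc, CharTwo.add_self_eq_zero, add_zero]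
    · simpa using ih (halfSet 1 I) _

/-- The LLR vector `y` with the signs changed on the support of the binary word `c`. -/
def flipBy {N : ℕ} (c : Fin N → ZMod 2) (y : Fin N → ℝ) : Fin N → ℝ :=
  fun i => if c i = 0 then y i else -y i

theorem zmod_two_eq_zero_or_one (a : ZMod 2) : a = 0 ∨ a = 1 := by
  revert a; decide

theorem llrMinus_flipBy {n : ℕ} (c : Fin (2 ^ (n + 1)) → ZMod 2) (y : Fin (2 ^ (n + 1)) → ℝ) :
    llrMinus (flipBy c y) =
      flipBy (fun i => c (half n (0, i)) + c (half n (1, i))) (llrMinus y) := by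
  funext i
  simp only [llrMinus, flipBy]
  rcases zmod_two_eq_zero_or_one (c (half n (0, i))) with h | h <;>
  rcases zmod_two_eq_zero_or_one (c (half n (1, i))) with h' | h' <;>
  simp [h, h', Real.sign_neg, CharTwo.add_self_eq_zero]

theorem llrPlus_flipBy {n : ℕ} (w : Fin (2 ^ n) → ZMod 2) (c : Fin (2 ^ (n + 1)) → ZMod 2)
    (y : Fin (2 ^ (n + 1)) → ℝ) :
    llrPlus (w + fun i => c (half n (0, i)) + c (half n (1, i))) (flipBy c y) =
      flipBy (fun i => c (half n (1, i))) (llrPlus w y) := by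
  funext i
  simp only [llrPlus, flipBy, Pi.add_apply]
  rcases zmod_two_eq_zero_or_one (c (half n (0, i))) with h | h <;>
  rcases zmod_two_eq_zero_or_one (c (half n (1, i))) with h' | h' <;>
  rcases zmod_two_eq_zero_or_one (w i) with h'' | h'' <;>
  simp [h, h', h'', CharTwo.add_self_eq_zero] <;> ring

/-- Symmetry of the decoder: changing the signs of the LLRs along a codeword adds that codeword
to the decision and creates no ties. -/
theorem scDec_flipBy {n : ℕ} {I : Set (Fin (2 ^ n))} {c : Fin (2 ^ n) → ZMod 2} (hc : c ∈ code I)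
    {y : Fin (2 ^ n) → ℝ} (hy : NoTie n I y) :
    NoTie n I (flipBy c y) ∧ scDec n I (flipBy c y) = scDec n I y + c := by
  induction n with
  | zero =>
    rw [mem_code_zero] at hc
    refine ⟨fun i hi => ?_, funext fun i => ?_⟩
    · have := hy i hi
      simp only [flipBy]
      split_ifs <;> simpa
    · simp only [scDec, flipBy, Pi.add_apply]
      by_cases hi : i ∈ I
      · rcases zmod_two_eq_zero_or_one (c i) with h | h
        · simp [hi, h]
        · rcases (hy i hi).lt_or_gt with h' | h'
          · simp [hi, h, h', h'.le, CharTwo.add_self_eq_zero]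
          · simp [hi, h, h', h'.le]
      · simp [hi, hc i hi]
  | succ n ih =>
    obtain ⟨hc₀, hc₁⟩ := mem_code_succ.1 hc
    obtain ⟨hy₀, hy₁⟩ := hy
    obtain ⟨t₀, e₀⟩ := ih hc₀ hy₀
    rw [← llrMinus_flipBy] at t₀ e₀
    obtain ⟨t₁, e₁⟩ := ih hc₁ hy₁
    rw [← llrPlus_flipBy, ← e₀] at t₁ e₁
    refine ⟨⟨t₀, t₁⟩, eq_of_half (fun i => ?_) fun i => ?_⟩
    · rw [Pi.add_apply, scDec_succ_zero, scDec_succ_zero, e₁, e₀, Pi.add_apply, Pi.add_apply]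
      generalize scDec n (halfSet 0 I) (llrMinus y) i = a
      generalize scDec n (halfSet 1 I) _ i = b
      generalize c (half n (0, i)) = d
      generalize c (half n (1, i)) = e
      revert a b d e; decide
    · rw [Pi.add_apply, scDec_succ_one, scDec_succ_one, e₁, Pi.add_apply]

/-! ### Triangular permutations -/

/-- Permutations of `Z_{2^n}` that are triangular with respect to the binary expansion: each bit
of the image is the same bit of the argument plus a function of the less significant bits. -/
def IsTriangular : (n : ℕ) → Equiv.Perm (Fin (2 ^ n)) → Prop
  | 0, _ => True
  | n + 1, π => ∃ π' : Equiv.Perm (Fin (2 ^ n)), IsTriangular n π' ∧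
      ∃ f : Fin (2 ^ n) → Fin 2, ∀ a i, π (half n (a, i)) = half n (a + f i, π' i)

theorem fin_two_eq_zero_or_one (a : Fin 2) : a = 0 ∨ a = 1 := by
  revert a; decide

/-- A triangular permutation that preserves a polar code commutes with its SC decoder. The swaps of
the two halves that it contains change signs in the LLRs `l⁺`, but the changes form a word of
the second component code, so that `scDec_flipBy` applies. -/
theorem IsTriangular.scDec_permute {n : ℕ} {I : Set (Fin (2 ^ n))} {π : Equiv.Perm (Fin (2 ^ n))}
    (hπ : IsTriangular n π) (hI : ∀ x ∈ code I, permute π x ∈ code I) {y : Fin (2 ^ n) → ℝ}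
    (hy : NoTie n I y) : NoTie n I (permute π y) ∧
      scDec n I (permute π y) = permute π (scDec n I y) := by
  induction n with
  | zero =>
    obtain rfl : π = 1 := Equiv.ext fun i => Subsingleton.elim (α := Fin 1) _ _
    exact ⟨hy, rfl⟩
  | succ n ih =>
    obtain ⟨π', hπ', f, hf⟩ := hπ
    obtain ⟨hy₀, hy₁⟩ := hy
    -- Apply `π` to the codewords `(x, 0)` and `(x, x)` to compare it with the component codes.
    have key : ∀ x ∈ code (halfSet 0 I), permute π' x ∈ code (halfSet 0 I) ∧
        (fun i => if f i = 0 then 0 else x (π' i)) ∈ code (halfSet 1 I) := by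
      intro x hx
      have hx' : (fun k => if ((half n).symm k).1 = 0 then x ((half n).symm k).2 else 0) ∈
          code I := by
        refine mem_code_succ.2 ⟨?_, ?_⟩
        · simpa using hx
        · simp only [Equiv.symm_apply_apply, one_ne_zero, if_false]
          exact ⟨0, fun _ _ => rfl, (zero_vecMul _).symm⟩
      obtain ⟨h0, h1⟩ := mem_code_succ.1 (hI _ hx')
      constructor
      · convert h0 using 1
        funext i
        rcases fin_two_eq_zero_or_one (f i) with h | h <;> simp [permute, hf, h]
      · convert h1 using 1
        funext i
        rcases fin_two_eq_zero_or_one (f i) with h | h <;> simp [permute, hf, h]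
    have key₁ : ∀ x ∈ code (halfSet 1 I), permute π' x ∈ code (halfSet 1 I) := by
      intro x hx
      have hx' : (fun k => x ((half n).symm k).2) ∈ code I := by
        refine mem_code_succ.2 ⟨?_, ?_⟩
        · simp only [Equiv.symm_apply_apply, CharTwo.add_self_eq_zero]
          exact ⟨0, fun _ _ => rfl, (zero_vecMul _).symm⟩
        · simpa using hx
      have h1 := (mem_code_succ.1 (hI _ hx')).2
      simp only [permute, hf, Equiv.symm_apply_apply] at h1
      exact h1
    have hm : llrMinus (permute π y) = permute π' (llrMinus y) := by
      funext i
      rcases fin_two_eq_zero_or_one (f i) with h | h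
      · simp [llrMinus, permute, hf, h]
      · simp [llrMinus, permute, hf, h, mul_comm, min_comm]
    obtain ⟨t₀, e₀⟩ := ih hπ' (fun x hx => (key x hx).1) hy₀
    rw [← hm] at t₀ e₀
    obtain ⟨t₁, e₁⟩ := ih hπ' key₁ hy₁
    set w := scDec n (halfSet 0 I) (llrMinus y) with hw
    have hp : llrPlus (permute π' w) (permute π y) =
        flipBy (fun i => if f i = 0 then 0 else w (π' i)) (permute π' (llrPlus w y)) := by
      funext i
      rcases fin_two_eq_zero_or_one (f i) with h | h
      · simp [llrPlus, permute, flipBy, hf, h]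
      · rcases zmod_two_eq_zero_or_one (w (π' i)) with h' | h' <;>
        simp [llrPlus, permute, flipBy, hf, h, h', add_comm]
    obtain ⟨t₂, e₂⟩ := scDec_flipBy (key w (scDec_mem_code _ _)).2 t₁
    rw [← hp, ← e₀] at t₂ e₂
    refine ⟨⟨t₀, t₂⟩, eq_of_half (fun i => ?_) fun i => ?_⟩
    · rw [scDec_succ_zero, e₂, e₁, e₀]
      rcases fin_two_eq_zero_or_one (f i) with h | h
      · simp [permute, hf, h, ← hw]
      · simp only [permute, hf, h, Pi.add_apply, zero_add, scDec_succ_one, ← hw, one_ne_zero,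
          if_false]
        rw [add_comm, add_assoc, CharTwo.add_self_eq_zero, add_zero]
    · rw [scDec_succ_one, e₂, e₁]
      rcases fin_two_eq_zero_or_one (f i) with h | h
      · simp [permute, hf, h, ← hw]
      · simp [permute, hf, h, ← hw, add_comm]

/-! ### Generic LLR vectors -/

/-- The LLR vectors whose entries satisfy no nontrivial linear relation with integer
coefficients. -/
def IsGeneric {ι : Type*} [Fintype ι] (y : ι → ℝ) : Prop :=
  ∀ g : ι → ℤ, ∑ i, (g i : ℝ) * y i = 0 → g = 0

theorem IsGeneric.ne_zero {ι : Type*} [Fintype ι] {y : ι → ℝ} (hy : IsGeneric y) (i : ι) :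
    y i ≠ 0 := by
  classical
  intro h
  have := congrFun (hy (Pi.single i 1) (by simp [Pi.single_apply, h])) i
  simp at this

theorem IsGeneric.comp_equiv {ι κ : Type*} [Fintype ι] [Fintype κ] {y : ι → ℝ} (hy : IsGeneric y)
    (e : κ ≃ ι) : IsGeneric (fun k => y (e k)) := by
  intro g hg
  have := hy (fun i => g (e.symm i)) (by rw [← e.sum_comp]; simpa using hg)
  funext k
  simpa using congrFun this (e k)

theorem dense_isGeneric (ι : Type*) [Fintype ι] : Dense {y : ι → ℝ | IsGeneric y} := by
  have h : {y : ι → ℝ | IsGeneric y} =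
      ⋂ g : {g : ι → ℤ // g ≠ 0}, {y | ∑ i, (g.1 i : ℝ) * y i ≠ 0} := by
    ext y
    simp only [IsGeneric, Set.mem_ofPred_eq, Set.mem_iInter, Subtype.forall]
    exact forall_congr' fun g => ⟨mt, fun h h' => by_contra fun h'' => h h'' h'⟩
  rw [h]
  refine dense_iInter_of_isOpen (fun g => ?_) fun ⟨g, hg⟩ => ?_
  · exact isOpen_ne_fun (by fun_prop) continuous_const
  · intro y
    -- Moving from a point of the hyperplane in the direction `g` leaves it at once.
    by_cases hy : ∑ i, (g i : ℝ) * y i = 0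
    · have hg' : ∑ i, (g i : ℝ) * g i ≠ 0 := by
        obtain ⟨i, hi⟩ := Function.ne_iff.1 hg
        refine (Finset.sum_pos' (fun i _ => mul_self_nonneg _) ⟨i, Finset.mem_univ _, ?_⟩).ne'
        exact mul_self_pos.2 (by simpa using hi)
      have hc : Tendsto (fun t : ℝ => y + t • fun i => (g i : ℝ)) (𝓝[≠] 0) (𝓝 y) := by
        have : Continuous fun t : ℝ => y + t • fun i => (g i : ℝ) := by fun_prop
        simpa using (this.tendsto 0).mono_left nhdsWithin_le_nhds
      refine mem_closure_of_tendsto hc (eventually_mem_nhdsWithin.mono fun t ht => ?_)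
      have : ∑ i, (g i : ℝ) * (y i + t * g i) = t * ∑ i, (g i : ℝ) * g i := by
        simp only [mul_add, Finset.sum_add_distrib, hy, zero_add, Finset.mul_sum]
        exact Finset.sum_congr rfl fun i _ => by ring
      simpa [this] using ⟨ht, hg'⟩
    · exact subset_closure hy

/-! ### Generic vectors are tie-free -/

theorem sum_half {n : ℕ} {M : Type*} [AddCommMonoid M] (F : Fin (2 ^ (n + 1)) → M) :
    ∑ k, F k = ∑ i, F (half n (0, i)) + ∑ i, F (half n (1, i)) := by
  rw [← (half n).sum_comp, Fintype.sum_prod_type, Fin.sum_univ_two]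

theorem sign_mul_sign_mul_min (a b : ℝ) :
    Real.sign a * Real.sign b * min |a| |b| = (|a + b| - |a - b|) / 2 := by
  rcases lt_trichotomy a 0 with ha | rfl | ha
  · rcases lt_trichotomy b 0 with hb | rfl | hb
    · rw [Real.sign_of_neg ha, Real.sign_of_neg hb, abs_of_neg ha, abs_of_neg hb,
        abs_of_neg (add_neg ha hb)]
      rcases le_total a b with h | h
      · rw [min_eq_right (by linarith), abs_of_nonpos (by linarith)]; ring
      · rw [min_eq_left (by linarith), abs_of_nonneg (by linarith)]; ring
    · simp
    · rw [Real.sign_of_neg ha, Real.sign_of_pos hb, abs_of_neg ha, abs_of_pos hb,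
        abs_of_neg (by linarith : a - b < 0)]
      rcases le_total (-a) b with h | h
      · rw [min_eq_left h, abs_of_nonneg (by linarith)]; ring
      · rw [min_eq_right h, abs_of_nonpos (by linarith)]; ring
  · simp
  · rcases lt_trichotomy b 0 with hb | rfl | hb
    · rw [Real.sign_of_pos ha, Real.sign_of_neg hb, abs_of_pos ha, abs_of_neg hb,
        abs_of_pos (by linarith : 0 < a - b)]
      rcases le_total a (-b) with h | h
      · rw [min_eq_left h, abs_of_nonpos (by linarith)]; ring
      · rw [min_eq_right h, abs_of_nonneg (by linarith)]; ring
    · simp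
    · rw [Real.sign_of_pos ha, Real.sign_of_pos hb, abs_of_pos ha, abs_of_pos hb,
        abs_of_pos (add_pos ha hb)]
      rcases le_total a b with h | h
      · rw [min_eq_left h, abs_of_nonpos (by linarith)]; ring
      · rw [min_eq_right h, abs_of_nonneg (by linarith)]; ring

theorem llrMinus_eq {n : ℕ} (y : Fin (2 ^ (n + 1)) → ℝ) (i : Fin (2 ^ n)) :
    llrMinus y i = (|y (half n (0, i)) + y (half n (1, i))| -
      |y (half n (0, i)) - y (half n (1, i))|) / 2 :=
  sign_mul_sign_mul_min _ _

theorem continuous_llrMinus {n : ℕ} :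
    Continuous (llrMinus : (Fin (2 ^ (n + 1)) → ℝ) → Fin (2 ^ n) → ℝ) := by
  refine continuous_pi fun i => ?_
  simp only [llrMinus_eq]
  fun_prop

theorem continuous_llrPlus {n : ℕ} (w : Fin (2 ^ n) → ZMod 2) :
    Continuous (llrPlus w : (Fin (2 ^ (n + 1)) → ℝ) → Fin (2 ^ n) → ℝ) := by
  refine continuous_pi fun i => ?_
  simp only [llrPlus]
  split_ifs <;> fun_prop

/-- Each entry of `llrMinus y` is, up to sign, an entry of `y` from the same pair. -/
theorem llrMinus_eq_coeff {n : ℕ} (y : Fin (2 ^ (n + 1)) → ℝ) (i : Fin (2 ^ n)) :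
    ∃ a b : ℤ, (a ≠ 0 ∨ b ≠ 0) ∧
      llrMinus y i = a * y (half n (0, i)) + b * y (half n (1, i)) := by
  rw [llrMinus_eq]
  generalize y (half n (0, i)) = u
  generalize y (half n (1, i)) = v
  rcases abs_cases (u + v) with ⟨h, _⟩ | ⟨h, _⟩ <;> rcases abs_cases (u - v) with ⟨h', _⟩ | ⟨h', _⟩
  · exact ⟨0, 1, by simp, by rw [h, h']; push_cast; ring⟩
  · exact ⟨1, 0, by simp, by rw [h, h']; push_cast; ring⟩
  · exact ⟨-1, 0, by simp, by rw [h, h']; push_cast; ring⟩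
  · exact ⟨0, -1, by simp, by rw [h, h']; push_cast; ring⟩

/-- Nonzero integer combinations within the pairs `(y_i, y_{i + 2^n})` of a generic vector form a
generic vector. -/
theorem IsGeneric.of_pairs {n : ℕ} {y : Fin (2 ^ (n + 1)) → ℝ} (hy : IsGeneric y)
    {z : Fin (2 ^ n) → ℝ} (h : ∀ i, ∃ a b : ℤ, (a ≠ 0 ∨ b ≠ 0) ∧
      z i = a * y (half n (0, i)) + b * y (half n (1, i))) : IsGeneric z := by
  choose a b hab hz using h
  intro g hg
  have := hy (fun k => if ((half n).symm k).1 = 0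
    then g ((half n).symm k).2 * a ((half n).symm k).2
    else g ((half n).symm k).2 * b ((half n).symm k).2) (by
      rw [sum_half, ← Finset.sum_add_distrib, ← hg]
      refine Finset.sum_congr rfl fun i _ => ?_
      simp [hz]
      ring)
  funext i
  have h0 := congrFun this (half n (0, i))
  have h1 := congrFun this (half n (1, i))
  simp only [Equiv.symm_apply_apply, if_true, one_ne_zero, if_false, Pi.zero_apply,
    mul_eq_zero] at h0 h1
  have := hab i
  simp only [Pi.zero_apply]
  tauto

theorem IsGeneric.noTie {n : ℕ} (I : Set (Fin (2 ^ n))) {y : Fin (2 ^ n) → ℝ} (hy : IsGeneric y) :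
    NoTie n I y := by
  induction n with
  | zero => exact fun i _ => hy.ne_zero i
  | succ n ih =>
    refine ⟨ih _ (hy.of_pairs (llrMinus_eq_coeff y)), ih _ (hy.of_pairs fun i => ?_)⟩
    simp only [llrPlus]
    split_ifs
    · exact ⟨1, 1, by simp, by simp⟩
    · exact ⟨-1, 1, by simp, by simp⟩

/-- The decoder is locally constant at tie-free vectors, and these form an open set. -/
theorem NoTie.eventually {n : ℕ} {I : Set (Fin (2 ^ n))} {y : Fin (2 ^ n) → ℝ} (hy : NoTie n I y) :
    ∀ᶠ z in 𝓝 y, NoTie n I z ∧ scDec n I z = scDec n I y := by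
  induction n with
  | zero =>
    have h : ∀ i, ∀ᶠ z in 𝓝 y, i ∈ I → z i ≠ 0 ∧ (z i < 0 ↔ y i < 0) := by
      intro i
      by_cases hi : i ∈ I
      · have hc : Tendsto (fun z : Fin (2 ^ 0) → ℝ => z i) (𝓝 y) (𝓝 (y i)) :=
          (continuous_apply i).tendsto y
        rcases (hy i hi).lt_or_gt with h | h
        · filter_upwards [hc.eventually (gt_mem_nhds h)] with z hz _
          exact ⟨hz.ne, iff_of_true hz h⟩
        · filter_upwards [hc.eventually (lt_mem_nhds h)] with z hz _
          exact ⟨hz.ne', iff_of_false hz.not_gt h.not_gt⟩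
      · exact Eventually.of_forall fun z hi' => absurd hi' hi
    filter_upwards [eventually_all.2 h] with z hz
    refine ⟨fun i hi => (hz i hi).1, funext fun i => ?_⟩
    have : i ∈ I ∧ z i < 0 ↔ i ∈ I ∧ y i < 0 := and_congr_right fun hi => (hz i hi).2
    simp only [scDec]
    by_cases h' : i ∈ I ∧ y i < 0
    · rw [if_pos h', if_pos (this.2 h')]
    · rw [if_neg h', if_neg (mt this.1 h')]
  | succ n ih =>
    obtain ⟨hy₀, hy₁⟩ := hy
    filter_upwards [continuous_llrMinus.tendsto y (ih hy₀),
      (continuous_llrPlus _).tendsto y (ih hy₁)] with z h₀ h₁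
    obtain ⟨t₀, e₀⟩ := h₀
    obtain ⟨t₁, e₁⟩ := h₁
    rw [← e₀] at t₁
    refine ⟨⟨t₀, t₁⟩, ?_⟩
    simp only [scDec, e₀, e₁]

theorem continuous_permute {N : ℕ} (π : Equiv.Perm (Fin N)) :
    Continuous (permute π : (Fin N → ℝ) → Fin N → ℝ) :=
  continuous_pi fun i => continuous_apply (π i)

/-- Two decodings that agree up to a permutation at all generic LLR vectors do so wherever both are
determined, as the decoder is locally constant there. -/
theorem scDec_permute_of_isGeneric {n : ℕ} {I : Set (Fin (2 ^ n))} {π : Equiv.Perm (Fin (2 ^ n))}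
    (h : ∀ y, IsGeneric y → scDec n I (permute π y) = permute π (scDec n I y))
    {y : Fin (2 ^ n) → ℝ} (hy : NoTie n I y) (hy' : NoTie n I (permute π y)) :
    scDec n I (permute π y) = permute π (scDec n I y) := by
  obtain ⟨z, hz, ⟨-, h₁⟩, -, h₂⟩ := (dense_isGeneric (Fin (2 ^ n))).inter_nhds_nonempty
    (hy.eventually.and ((continuous_permute π).tendsto y hy'.eventually))
  rw [← h₁, ← h₂]
  exact h z hz

theorem aScDec_eq_iff {n : ℕ} {I : Set (Fin (2 ^ n))} {π : Equiv.Perm (Fin (2 ^ n))}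
    {y : Fin (2 ^ n) → ℝ} :
    aScDec I y π = scDec n I y ↔ scDec n I (permute π y) = permute π (scDec n I y) := by
  constructor
  · intro h
    rw [← h]
    funext i
    simp [aScDec, permute]
  · intro h
    rw [aScDec, h]
    funext i
    simp [permute]

/-- Absorption may be tested on generic LLR vectors, which are tie-free along with all their
permutations. -/
theorem mem_absorbed_iff {n : ℕ} {I : Set (Fin (2 ^ n))} {π : Equiv.Perm (Fin (2 ^ n))} :
    π ∈ absorbed I ↔ π ∈ affineAut I ∧
      ∀ y, IsGeneric y → scDec n I (permute π y) = permute π (scDec n I y) := by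
  refine and_congr_right fun _ => ⟨fun h y hy => ?_, fun h y hy hy' => ?_⟩
  · exact aScDec_eq_iff.1 (h y (hy.noTie I) ((hy.comp_equiv π).noTie I))
  · exact aScDec_eq_iff.2 (scDec_permute_of_isGeneric h hy hy')

/-! ### Overgroups of the unitriangular group over `F_2` -/

section Transvections

variable {n : ℕ}

theorem one_add_vecMulVec_mul (a b c d : Fin n → ZMod 2) :
    (1 + vecMulVec a b) * (1 + vecMulVec c d) =
      1 + vecMulVec a b + vecMulVec c d + (b ⬝ᵥ c) • vecMulVec a d := by
  rw [add_mul, mul_add, mul_add, vecMulVec_mul_vecMulVec, one_mul, one_mul, mul_one,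
    vecMulVec_smul]
  abel

theorem one_add_vecMulVec_mul_self {a b : Fin n → ZMod 2} (h : b ⬝ᵥ a = 0) :
    (1 + vecMulVec a b) * (1 + vecMulVec a b) = 1 := by
  rw [one_add_vecMulVec_mul, h, zero_smul, add_zero, add_assoc, add_eq_left]
  ext i j
  exact CharTwo.add_self_eq_zero _

end Transvections

/-- The groups of invertible matrices over `F_2`, as sets of matrices, that contain the lower
unitriangular matrices. -/
structure IsParabolic {n : ℕ} (P : Set (Matrix (Fin n) (Fin n) (ZMod 2))) : Prop where
  isUnit : ∀ A ∈ P, IsUnit A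
  mul : ∀ A ∈ P, ∀ B ∈ P, A * B ∈ P
  inv : ∀ A ∈ P, A⁻¹ ∈ P
  lower : ∀ A : Matrix (Fin n) (Fin n) (ZMod 2), (∀ i j, i < j → A i j = 0) → (∀ i, A i i = 1) →
    A ∈ P

/-- The span of the coordinate vectors of index at least `k` is invariant under `P`. -/
def IsCut {n : ℕ} (P : Set (Matrix (Fin n) (Fin n) (ZMod 2))) (k : ℕ) : Prop :=
  ∀ A ∈ P, ∀ i j : Fin n, (i : ℕ) < k → k ≤ j → A i j = 0

namespace IsParabolic

variable {n : ℕ} {P : Set (Matrix (Fin n) (Fin n) (ZMod 2))} (hP : IsParabolic P)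
include hP

theorem conj {A B : Matrix (Fin n) (Fin n) (ZMod 2)} (hA : A ∈ P) (hB : B ∈ P) :
    A * B * A⁻¹ ∈ P :=
  hP.mul _ (hP.mul _ hA _ hB) _ (hP.inv _ hA)

/-- Conjugates of the transvection `1 + x yᵀ` are the `1 + (A x) (y A⁻¹)ᵀ`. -/
theorem conj_one_add_vecMulVec {A : Matrix (Fin n) (Fin n) (ZMod 2)} (hA : A ∈ P)
    {x y : Fin n → ZMod 2} (h : 1 + vecMulVec x y ∈ P) :
    1 + vecMulVec (A *ᵥ x) (y ᵥ* A⁻¹) ∈ P := by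
  have := hP.conj hA h
  rwa [mul_add, mul_one, add_mul, mul_nonsing_inv _ ((isUnit_iff_isUnit_det _).1 (hP.isUnit _ hA)),
    mul_vecMulVec, vecMulVec_mul] at this

theorem lower_one_add_vecMulVec {x y : Fin n → ZMod 2} (h : ∀ i j, i ≤ j → x i = 0 ∨ y j = 0) :
    1 + vecMulVec x y ∈ P := by
  refine hP.lower _ (fun i j hij => ?_) fun i => ?_
  · rw [Matrix.add_apply, one_apply_ne hij.ne, vecMulVec_apply]
    rcases h i j hij.le with h | h <;> simp [h]
  · rw [Matrix.add_apply, one_apply_eq, vecMulVec_apply]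
    rcases h i i le_rfl with h | h <;> simp [h]

theorem transvection_of_lt {i j : Fin n} (h : j < i) : transvection i j (1 : ZMod 2) ∈ P := by
  rw [transvection, single_eq_single_vecMulVec_single]
  refine hP.lower_one_add_vecMulVec fun a b hab => ?_
  by_contra! hh
  have h1 : a = i := by by_contra h'; simp [h'] at hh
  have h2 : b = j := by by_contra h'; simp [h'] at hh
  omega

/-- The elementary transvection of the entry `(i, k)` is the commutator of those of `(i, j)` and
`(j, k)`. -/
theorem transvection_trans {i j k : Fin n} (hij : i ≠ j) (hjk : j ≠ k) (hik : i ≠ k)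
    (h₁ : transvection i j (1 : ZMod 2) ∈ P) (h₂ : transvection j k (1 : ZMod 2) ∈ P) :
    transvection i k (1 : ZMod 2) ∈ P := by
  have := hP.mul _ (hP.mul _ (hP.mul _ h₁ _ h₂) _ h₁) _ h₂
  convert this using 1
  simp only [transvection, mul_add, add_mul, mul_one, one_mul, single_mul_single_same,
    single_mul_single_of_ne _ _ _ _ hij.symm, single_mul_single_of_ne _ _ _ _ hjk.symm,
    single_mul_single_of_ne _ _ _ _ hik.symm, add_zero]
  ext a b
  simp only [Matrix.add_apply]
  generalize (1 : Matrix (Fin n) (Fin n) (ZMod 2)) a b = u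
  generalize Matrix.single i j (1 : ZMod 2) a b = v
  generalize Matrix.single j k (1 : ZMod 2) a b = w
  generalize Matrix.single i k (1 : ZMod 2) a b = z
  revert u v w z
  decide

/-- A transvection `1 + x yᵀ` in `P` that moves the span of the coordinate vectors of index at least
`k` can be conjugated by lower triangular matrices to an elementary transvection that also moves
it. -/
theorem exists_transvection {k : ℕ} {x y : Fin n → ZMod 2} (h : 1 + vecMulVec x y ∈ P)
    (hxy : y ⬝ᵥ x = 0) {i j : Fin n} (hi : (i : ℕ) < k) (hj : k ≤ j) (hx : x i = 1) (hy : y j = 1) :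
    ∃ p q : Fin n, (p : ℕ) < k ∧ k ≤ q ∧ transvection p q (1 : ZMod 2) ∈ P := by
  classical
  obtain ⟨p, hp, hpmin⟩ := Finset.exists_min_image (Finset.univ.filter fun i => x i = 1) id
    ⟨i, by simpa using hx⟩
  simp only [Finset.mem_filter_univ, id] at hp hpmin
  have hpk : (p : ℕ) < k := lt_of_le_of_lt (hpmin i hx) hi
  -- Conjugation by `1 + (x - e_p) e_pᵀ` takes `x` to `e_p`, where `p` is the first index of `x`.
  have hL : 1 + vecMulVec (x - Pi.single p 1) (Pi.single p 1) ∈ P := by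
    refine hP.lower_one_add_vecMulVec fun a b hab => ?_
    by_contra! hh
    have hb : b = p := by by_contra h'; simp [h'] at hh
    subst hb
    have ha : a ≠ b := by rintro rfl; simp [hp] at hh
    have hxa : x a = 1 := by
      rcases zmod_two_eq_zero_or_one (x a) with h' | h'
      · simp [h', ha] at hh
      · exact h'
    exact ha (le_antisymm hab (hpmin a hxa))
  have hL2 : (Pi.single p 1 : Fin n → ZMod 2) ⬝ᵥ (x - Pi.single p 1) = 0 := by
    simp [hp]
  have h₁ := hP.conj_one_add_vecMulVec hL h
  rw [inv_eq_left_inv (one_add_vecMulVec_mul_self hL2)] at h₁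
  set y' := y - Pi.single p (y p) with hy'
  have e₁ : (1 + vecMulVec (x - Pi.single p 1) (Pi.single p 1)) *ᵥ x = Pi.single p 1 := by
    rw [add_mulVec, one_mulVec, vecMulVec_mulVec]
    ext a
    simp [hp, CharTwo.sub_eq_add, ← add_assoc, CharTwo.add_self_eq_zero]
  have e₂ : y ᵥ* (1 + vecMulVec (x - Pi.single p 1) (Pi.single p 1)) = y' := by
    rw [vecMul_add, vecMul_one, vecMul_vecMulVec, dotProduct_sub, hxy]
    ext a
    by_cases ha : a = p <;> simp [hy', ha, CharTwo.sub_eq_add, CharTwo.add_self_eq_zero]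
  rw [e₁, e₂] at h₁
  have hyj : y' j = 1 := by
    have : j ≠ p := by rintro rfl; omega
    simp [hy', this, hy]
  obtain ⟨q, hq, hqmax⟩ := Finset.exists_max_image (Finset.univ.filter fun i => y' i = 1) id
    ⟨j, by simpa using hyj⟩
  simp only [Finset.mem_filter_univ, id] at hq hqmax
  have hkq : k ≤ q := hj.trans (hqmax j hyj)
  have hyp : y' p = 0 := by simp [hy']
  -- Conjugation by `1 + e_q (y' - e_q)ᵀ` takes `y'` to `e_q`, where `q` is the last index of `y'`.
  have hM : 1 + vecMulVec (Pi.single q 1) (y' - Pi.single q 1) ∈ P := by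
    refine hP.lower_one_add_vecMulVec fun a b hab => ?_
    by_contra! hh
    have ha : a = q := by by_contra h'; simp [h'] at hh
    subst ha
    have hb : b ≠ a := by rintro rfl; simp [hq] at hh
    have hyb : y' b = 1 := by
      rcases zmod_two_eq_zero_or_one (y' b) with h' | h'
      · simp [h', hb] at hh
      · exact h'
    exact hb (le_antisymm (hqmax b hyb) hab)
  have hM2 : (y' - Pi.single q 1) ⬝ᵥ (Pi.single q 1 : Fin n → ZMod 2) = 0 := by
    simp [hq]
  have h₂ := hP.conj_one_add_vecMulVec hM h₁
  rw [inv_eq_left_inv (one_add_vecMulVec_mul_self hM2)] at h₂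
  have hpq : p ≠ q := by rintro rfl; omega
  have e₃ : (1 + vecMulVec (Pi.single q 1) (y' - Pi.single q 1)) *ᵥ Pi.single p 1 =
      (Pi.single p 1 : Fin n → ZMod 2) := by
    rw [add_mulVec, one_mulVec, vecMulVec_mulVec]
    simp [hyp, hpq]
  have e₄ : y' ᵥ* (1 + vecMulVec (Pi.single q 1) (y' - Pi.single q 1)) = Pi.single q 1 := by
    rw [vecMul_add, vecMul_one, vecMul_vecMulVec]
    ext a
    simp [hq, CharTwo.sub_eq_add, ← add_assoc, CharTwo.add_self_eq_zero]
  rw [e₃, e₄, ← single_eq_single_vecMulVec_single] at h₂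
  exact ⟨p, q, hpk, hkq, h₂⟩

theorem transvection_succ_of_not_isCut {i j : Fin n} (hij : (i : ℕ) + 1 = j) (h : ¬ IsCut P j) :
    transvection i j (1 : ZMod 2) ∈ P := by
  simp only [IsCut, not_forall] at h
  obtain ⟨A, hA, a, b, ha, hb, hab⟩ := h
  have hdet := (isUnit_iff_isUnit_det _).1 (hP.isUnit _ hA)
  -- Otherwise `A⁻¹`, and with it `A`, would preserve the span of the vectors of index `≥ j`.
  have hAinv : ∃ c d : Fin n, (c : ℕ) < j ∧ (j : ℕ) ≤ d ∧ A⁻¹ c d = 1 := by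
    by_contra! hc
    have := invertibleOfIsUnitDet A hdet
    have : Invertible A⁻¹ := invertibleOfIsUnitDet _ (isUnit_nonsing_inv_det A hdet)
    have ht : A⁻¹.BlockTriangular (fun c : Fin n => if c < j then (1 : ℕ) else 0) := by
      intro c d hcd
      have h1 : c < j := by
        by_contra h'
        simp [h'] at hcd
      have h2 : ¬ d < j := by
        intro h'
        simp [h', h1] at hcd
      exact (zmod_two_eq_zero_or_one _).resolve_right (hc c d h1 (not_lt.1 h2))
    have ht' := blockTriangular_inv_of_blockTriangular ht
    rw [nonsing_inv_nonsing_inv _ hdet] at ht'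
    refine hab (ht' ?_)
    have h1 : a < j := ha
    have h2 : ¬ b < j := not_lt.2 hb
    simp [h1, h2]
  obtain ⟨c, d, hc, hd, hcd⟩ := hAinv
  -- Conjugation of a lower transvection by `A` yields `1 + x yᵀ` with `x` the column `b` of `A` and
  -- `y` the row `c` of `A⁻¹`.
  have h₁ := hP.transvection_of_lt (lt_of_lt_of_le hc hb)
  rw [transvection, single_eq_single_vecMulVec_single] at h₁
  have h₂ := hP.conj_one_add_vecMulVec hA h₁
  obtain ⟨p, q, hp, hq, hpq⟩ := hP.exists_transvection (k := j) h₂ (i := a) (j := d) (by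
      rw [← dotProduct_mulVec, mulVec_mulVec, nonsing_inv_mul _ hdet, one_mulVec]
      have : c ≠ b := by rintro rfl; omega
      simp [this]) ha hd (by simpa using (zmod_two_eq_zero_or_one _).resolve_left hab)
      (by simpa using hcd)
  have h₃ : transvection p j (1 : ZMod 2) ∈ P := by
    rcases eq_or_ne q j with rfl | hqj
    · exact hpq
    · exact hP.transvection_trans (by rintro rfl; omega) hqj (by rintro rfl; omega) hpq
        (hP.transvection_of_lt (lt_of_le_of_ne hq hqj.symm))
  rcases eq_or_ne i p with rfl | hip
  · exact h₃
  · exact hP.transvection_trans hip (by rintro rfl; omega) (by rintro rfl; omega)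
      (hP.transvection_of_lt (by omega)) h₃

theorem transvection_of_forall_not_isCut {i j : Fin n} (hij : i ≠ j)
    (h : ∀ k : ℕ, (i : ℕ) < k → k ≤ j → ¬ IsCut P k) : transvection i j (1 : ZMod 2) ∈ P := by
  rcases lt_or_gt_of_ne hij with hlt | hlt
  · obtain ⟨j, hj⟩ := j
    induction j with
    | zero => exact absurd hlt (Nat.not_lt_zero _)
    | succ m ih =>
      have hm : m < n := by omega
      have hs : transvection ⟨m, hm⟩ ⟨m + 1, hj⟩ (1 : ZMod 2) ∈ P :=
        hP.transvection_succ_of_not_isCut rfl (h (m + 1) hlt le_rfl)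
      rcases eq_or_ne i ⟨m, hm⟩ with rfl | hne
      · exact hs
      · have hlt' : i < ⟨m, hm⟩ := lt_of_le_of_ne (Nat.lt_succ_iff.1 hlt) hne
        exact hP.transvection_trans hne (by simp) hij
          (ih hm hne (fun k hk hk' => h k hk (le_trans hk' (Nat.le_succ m))) hlt') hs
  · exact hP.transvection_of_lt hlt

theorem one_mem : 1 ∈ P :=
  hP.lower _ (fun _ _ h => one_apply_ne h.ne) fun _ => one_apply_eq _

theorem one_add_vecMulVec_single_mem {m : Fin n} (r : Fin n → ZMod 2) (hm : r m = 0)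
    (hr : ∀ j, r j = 1 → transvection m j (1 : ZMod 2) ∈ P) :
    1 + vecMulVec (Pi.single m 1) r ∈ P := by
  classical
  have : ∀ s : Finset (Fin n),
      1 + vecMulVec (Pi.single m 1) (∑ j ∈ s, Pi.single j (r j)) ∈ P := by
    intro s
    induction s using Finset.induction_on with
    | empty => simpa [vecMulVec_zero] using hP.one_mem
    | insert a s ha ih =>
      rw [Finset.sum_insert ha]
      rcases zmod_two_eq_zero_or_one (r a) with h | h
      · simpa [h] using ih
      · have hma : a ≠ m := by rintro rfl; simp [hm] at h
        have h' := hP.mul _ (hr a h) _ ih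
        rw [transvection, single_eq_single_vecMulVec_single, one_add_vecMulVec_mul] at h'
        rw [h, vecMulVec_add, ← add_assoc]
        simpa [hma] using h'
  simpa [Finset.univ_sum_single] using this Finset.univ

/-- Block Gaussian elimination: once the first `m` rows are those of the identity, column operations
from `P` bring the next row into that form too. -/
theorem mem_of_rows {A : Matrix (Fin n) (Fin n) (ZMod 2)} (hA : IsUnit A)
    (hcut : ∀ k, IsCut P k → ∀ i j : Fin n, (i : ℕ) < k → k ≤ j → A i j = 0) {m : ℕ} (hm : m ≤ n)
    (hrows : ∀ i j : Fin n, (i : ℕ) < m → A i j = (1 : Matrix (Fin n) (Fin n) (ZMod 2)) i j) :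
    A ∈ P := by
  induction hd : n - m generalizing m A with
  | zero =>
    have : A = 1 := by
      ext i j
      exact hrows i j (by omega)
    rw [this]
    exact hP.one_mem
  | succ d ih =>
    have hmn : m < n := by omega
    set r : Fin n := ⟨m, hmn⟩ with hr
    have cutmul : ∀ {B C : Matrix (Fin n) (Fin n) (ZMod 2)},
        (∀ k, IsCut P k → ∀ i j : Fin n, (i : ℕ) < k → k ≤ j → B i j = 0) → C ∈ P →
        ∀ k, IsCut P k → ∀ i j : Fin n, (i : ℕ) < k → k ≤ j → (B * C) i j = 0 := by
      intro B C hB hC k hk i j hi hj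
      rw [mul_apply]
      refine Finset.sum_eq_zero fun l _ => ?_
      rcases lt_or_ge (l : ℕ) k with hl | hl
      · rw [hk C hC l j hl hj, mul_zero]
      · rw [hB k hk i l hi hl, zero_mul]
    -- It suffices to treat matrices with a nonzero diagonal entry in the row `r`.
    have main : ∀ B : Matrix (Fin n) (Fin n) (ZMod 2), IsUnit B →
        (∀ k, IsCut P k → ∀ i j : Fin n, (i : ℕ) < k → k ≤ j → B i j = 0) →
        (∀ i j : Fin n, (i : ℕ) < m → B i j = (1 : Matrix (Fin n) (Fin n) (ZMod 2)) i j) →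
        B r r = 1 → B ∈ P := by
      intro B hB hBcut hBrows hBr
      set v : Fin n → ZMod 2 := B r - Pi.single r 1 with hv
      have hvr : v r = 0 := by simp [hv, hBr]
      have hC : 1 + vecMulVec (Pi.single r 1) v ∈ P := by
        refine hP.one_add_vecMulVec_single_mem v hvr fun j hj => ?_
        have hjr : r ≠ j := by rintro rfl; simp [hvr] at hj
        refine hP.transvection_of_forall_not_isCut hjr fun k hk hk' hcut => ?_
        have := hBcut k hcut r j hk hk'
        simp [hv, hjr.symm, this] at hj
      have hCC : (1 + vecMulVec (Pi.single r 1) v) * (1 + vecMulVec (Pi.single r 1) v) = 1 :=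
        one_add_vecMulVec_mul_self (by simpa using hvr)
      have hBC : B * (1 + vecMulVec (Pi.single r 1) v) ∈ P := by
        refine ih (m := m + 1) (hB.mul (hP.isUnit _ hC)) (cutmul hBcut hC) hmn ?_ (by omega)
        intro i j hi
        rw [mul_add, mul_one, mul_vecMulVec, Matrix.add_apply, vecMulVec_apply, mulVec_single_one,
          col_apply]
        rcases Nat.lt_succ_iff_lt_or_eq.1 hi with hi | hi
        · have : i ≠ r := by rintro rfl; simp [hr] at hi
          rw [hBrows i r hi, one_apply_ne this, zero_mul, add_zero, hBrows i j hi]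
        · obtain rfl : i = r := Fin.ext hi
          rw [hBr, one_mul, hv, Pi.sub_apply, CharTwo.sub_eq_add, ← add_assoc,
            CharTwo.add_self_eq_zero, zero_add, one_apply, Pi.single_apply]
          simp [eq_comm]
      have := hP.mul _ hBC _ hC
      rwa [mul_assoc, hCC, mul_one] at this
    rcases zmod_two_eq_zero_or_one (A r r) with h0 | h1
    · have hdet := (isUnit_iff_isUnit_det _).1 hA
      -- A nonzero entry of the row `r` to the right of the diagonal is added to the diagonal.
      obtain ⟨c, hrc, hc⟩ : ∃ c, r < c ∧ A r c = 1 := by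
        by_contra! hc
        have h1 : (A * A⁻¹) r r = 1 := by rw [mul_nonsing_inv _ hdet, one_apply_eq]
        rw [mul_apply, Finset.sum_eq_zero] at h1
        · exact zero_ne_one h1
        intro l _
        rcases lt_trichotomy l r with hl | rfl | hl
        · have h2 : (A * A⁻¹) l r = 0 := by rw [mul_nonsing_inv _ hdet, one_apply_ne hl.ne]
          have h3 : A⁻¹ l r = 0 := by
            rw [← h2, mul_apply]
            simp only [hrows l _ hl, one_apply, ite_mul, one_mul, zero_mul, Finset.sum_ite_eq,
              Finset.mem_univ, if_true]
          rw [h3, mul_zero]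
        · rw [h0, zero_mul]
        · rw [(zmod_two_eq_zero_or_one _).resolve_right (hc l hl), zero_mul]
      have hT := hP.transvection_of_lt hrc
      have hTT : transvection c r (1 : ZMod 2) * transvection c r 1 = 1 := by
        rw [transvection_mul_transvection_same _ _ hrc.ne', CharTwo.add_self_eq_zero,
          transvection_zero]
      have hAT : A * transvection c r 1 ∈ P := by
        refine main _ (hA.mul (hP.isUnit _ hT)) (cutmul hcut hT) (fun i j hi => ?_) ?_
        · rcases eq_or_ne j r with rfl | hj
          · have : i ≠ c := by
              rintro rfl
              exact absurd hi (not_lt.2 hrc.le)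
            rw [mul_transvection_apply_same, one_mul, hrows i c hi, one_apply_ne this, add_zero,
              hrows i _ hi]
          · rw [mul_transvection_apply_of_ne _ _ _ _ hj, hrows i j hi]
        · rw [mul_transvection_apply_same, h0, hc]
          rfl
      have := hP.mul _ hAT _ hT
      rwa [mul_assoc, hTT, mul_one] at this
    · exact main A hA hcut hrows h1

/-- Overgroups of the lower unitriangular group over `F_2` are block triangular groups. -/
theorem mem_iff {A : Matrix (Fin n) (Fin n) (ZMod 2)} :
    A ∈ P ↔ IsUnit A ∧
      ∀ k, IsCut P k → ∀ i j : Fin n, (i : ℕ) < k → k ≤ j → A i j = 0 :=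
  ⟨fun h => ⟨hP.isUnit A h, fun _ hk => hk A h⟩,
    fun h => hP.mem_of_rows h.1 h.2 (Nat.zero_le n) fun _ _ hi => absurd hi (Nat.not_lt_zero _)⟩

end IsParabolic

/-! ### The binary expansion of a half -/

theorem bin_symm_snoc {n : ℕ} (v : Fin n → ZMod 2) (a : ZMod 2) :
    (bin (n + 1)).symm (Fin.snoc v a : Fin (n + 1) → ZMod 2) = half n (a, (bin n).symm v) := by
  ext
  simp only [bin, half, Equiv.trans_apply, finCongr_apply, Fin.val_cast,
    finProdFinEquiv_apply_val]
  erw [finFunctionFinEquiv_apply, finFunctionFinEquiv_apply]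
  rw [Fin.sum_univ_castSucc]
  simp [mul_comm]

theorem bin_half {n : ℕ} (a : ZMod 2) (i : Fin (2 ^ n)) :
    bin (n + 1) (half n (a, i)) = (Fin.snoc (bin n i) a : Fin (n + 1) → ZMod 2) := by
  have := bin_symm_snoc (bin n i) a
  rw [Equiv.symm_apply_apply] at this
  exact ((Equiv.symm_apply_eq _).1 this).symm

theorem bin_half_last {n : ℕ} (a : ZMod 2) (i : Fin (2 ^ n)) :
    bin (n + 1) (half n (a, i)) (Fin.last n) = a := by
  rw [bin_half, Fin.snoc_last]

theorem bin_half_castSucc {n : ℕ} (a : ZMod 2) (i : Fin (2 ^ n)) (k : Fin n) :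
    bin (n + 1) (half n (a, i)) k.castSucc = bin n i k := by
  rw [bin_half, Fin.snoc_castSucc]

/-! ### Affine permutations -/

theorem IsAffineWith.mul {n : ℕ} {A A' : Matrix (Fin n) (Fin n) (ZMod 2)} {b b' : Fin n → ZMod 2}
    {π π' : Equiv.Perm (Fin (2 ^ n))} (h : IsAffineWith A b π) (h' : IsAffineWith A' b' π') :
    IsAffineWith (A * A') (A *ᵥ b' + b) (π * π') := by
  intro v
  rw [Equiv.Perm.mul_apply, h, h', mulVec_add, mulVec_mulVec, add_assoc]

theorem IsAffineWith.perm_ext {n : ℕ} {A : Matrix (Fin n) (Fin n) (ZMod 2)} {b : Fin n → ZMod 2}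
    {π π' : Equiv.Perm (Fin (2 ^ n))} (h : IsAffineWith A b π) (h' : IsAffineWith A b π') :
    π = π' :=
  Equiv.ext fun v => (bin n).injective ((h v).trans (h' v).symm)

theorem IsAffineWith.matrix_ext {n : ℕ} {A A' : Matrix (Fin n) (Fin n) (ZMod 2)}
    {b b' : Fin n → ZMod 2} {π : Equiv.Perm (Fin (2 ^ n))} (h : IsAffineWith A b π)
    (h' : IsAffineWith A' b' π) : A = A' := by
  have key : ∀ v, A *ᵥ v + b = A' *ᵥ v + b' := fun v => by
    have := (h ((bin n).symm v)).symm.trans (h' ((bin n).symm v))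
    simpa using this
  have hb : b = b' := by simpa using key 0
  subst hb
  exact ext_of_mulVec_single fun j => add_right_cancel (key _)

theorem exists_isAffineWith {n : ℕ} {A : Matrix (Fin n) (Fin n) (ZMod 2)} (hA : IsUnit A)
    (b : Fin n → ZMod 2) : ∃ π, IsAffineWith A b π := by
  have hdet := (isUnit_iff_isUnit_det _).1 hA
  let e : Equiv.Perm (Fin n → ZMod 2) :=
    { toFun := fun v => A *ᵥ v + b
      invFun := fun v => A⁻¹ *ᵥ (v - b)
      left_inv := fun v => by simp [mulVec_mulVec, nonsing_inv_mul _ hdet]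
      right_inv := fun v => by simp [mulVec_mulVec, mul_nonsing_inv _ hdet] }
  exact ⟨((bin n).trans e).trans (bin n).symm, fun v => by simp [e]⟩

theorem IsAffineWith.inv {n : ℕ} {A : Matrix (Fin n) (Fin n) (ZMod 2)} {b : Fin n → ZMod 2}
    {π : Equiv.Perm (Fin (2 ^ n))} (hA : IsUnit A) (h : IsAffineWith A b π) :
    IsAffineWith A⁻¹ (-(A⁻¹ *ᵥ b)) π⁻¹ := by
  have hdet := (isUnit_iff_isUnit_det _).1 hA
  intro v
  have := h (π⁻¹ v)
  rw [show π (π⁻¹ v) = v from π.apply_symm_apply v] at this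
  rw [this, mulVec_add, mulVec_mulVec, nonsing_inv_mul _ hdet, one_mulVec, add_neg_cancel_right]

/-- With the least significant bit first, the last coordinate is the bit that tells the halves apart,
so lower unitriangular matrices give triangular permutations. -/
theorem isTriangular_of_isAffineWith {n : ℕ} {A : Matrix (Fin n) (Fin n) (ZMod 2)}
    {b : Fin n → ZMod 2} {π : Equiv.Perm (Fin (2 ^ n))} (hA : ∀ i j, i < j → A i j = 0)
    (hA' : ∀ i, A i i = 1) (h : IsAffineWith A b π) : IsTriangular n π := by
  induction n with
  | zero => trivial
  | succ n ih =>
    have hlow : ∀ i j, i < j → A.submatrix Fin.castSucc Fin.castSucc i j = 0 :=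
      fun i j hij => hA _ _ (Fin.castSucc_lt_castSucc_iff.2 hij)
    have hdiag : ∀ i, A.submatrix Fin.castSucc Fin.castSucc i i = 1 := fun i => hA' _
    have hunit : IsUnit (A.submatrix Fin.castSucc Fin.castSucc) := by
      rw [isUnit_iff_isUnit_det, det_of_isLowerTriangular _ fun i j hij => hlow i j hij]
      simp [hA']
    obtain ⟨π', hπ'⟩ := exists_isAffineWith hunit fun i => b i.castSucc
    refine ⟨π', ih hlow hdiag hπ',
      fun i => (∑ j : Fin n, A (Fin.last n) j.castSucc * bin n i j + b (Fin.last n) : ZMod 2),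
      fun a i => (bin (n + 1)).injective ?_⟩
    funext k
    rw [h]
    refine Fin.lastCases ?_ (fun k => ?_) k
    · refine Eq.trans ?_ (bin_half_last _ _).symm
      rw [Pi.add_apply, mulVec, dotProduct, Fin.sum_univ_castSucc, hA', one_mul,
        Finset.sum_congr rfl fun j _ => congrArg (A (Fin.last n) j.castSucc * ·)
          (bin_half_castSucc a i j)]
      exact (add_right_comm _ _ _).trans ((add_comm _ _).trans
        (congrArg (fun c : ZMod 2 => c + _) (bin_half_last a i)))
    · refine Eq.trans ?_ (bin_half_castSucc _ _ k).symm
      rw [hπ', Pi.add_apply, mulVec, dotProduct, Fin.sum_univ_castSucc,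
        hA _ _ (Fin.castSucc_lt_last k), zero_mul, add_zero,
        Finset.sum_congr rfl fun j _ => congrArg (A k.castSucc j.castSucc * ·)
          (bin_half_castSucc a i j)]
      rfl

/-! ### The group of absorbed automorphisms -/

theorem permute_mul {N : ℕ} {α : Type*} (π σ : Equiv.Perm (Fin N)) (x : Fin N → α) :
    permute (π * σ) x = permute σ (permute π x) := rfl

theorem permute_inv_permute {N : ℕ} {α : Type*} (π : Equiv.Perm (Fin N)) (x : Fin N → α) :
    permute π⁻¹ (permute π x) = x := by
  funext i
  simp [permute]

theorem permute_permute_inv {N : ℕ} {α : Type*} (π : Equiv.Perm (Fin N)) (x : Fin N → α) :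
    permute π (permute π⁻¹ x) = x := by
  funext i
  simp [permute]

theorem mul_mem_affineAut {n : ℕ} {I : Set (Fin (2 ^ n))} {π σ : Equiv.Perm (Fin (2 ^ n))}
    (hπ : π ∈ affineAut I) (hσ : σ ∈ affineAut I) : π * σ ∈ affineAut I := by
  obtain ⟨⟨A, b, hA, h⟩, e⟩ := hπ
  obtain ⟨⟨A', b', hA', h'⟩, e'⟩ := hσ
  refine ⟨⟨_, _, hA.mul hA', h.mul h'⟩, ?_⟩
  rw [show (permute (π * σ) : (Fin (2 ^ n) → ZMod 2) → _) = permute σ ∘ permute π from rfl,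
    Set.image_comp, e, e']

theorem inv_mem_affineAut {n : ℕ} {I : Set (Fin (2 ^ n))} {π : Equiv.Perm (Fin (2 ^ n))}
    (hπ : π ∈ affineAut I) : π⁻¹ ∈ affineAut I := by
  obtain ⟨⟨A, b, hA, h⟩, e⟩ := hπ
  refine ⟨⟨_, _, (isUnit_nonsing_inv_iff).2 hA, h.inv hA⟩, ?_⟩
  conv_lhs => rw [← e]
  rw [Set.image_image]
  simp [permute_inv_permute]

theorem mul_mem_absorbed {n : ℕ} {I : Set (Fin (2 ^ n))} {π σ : Equiv.Perm (Fin (2 ^ n))}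
    (hπ : π ∈ absorbed I) (hσ : σ ∈ absorbed I) : π * σ ∈ absorbed I := by
  rw [mem_absorbed_iff] at *
  refine ⟨mul_mem_affineAut hπ.1 hσ.1, fun y hy => ?_⟩
  have := hσ.2 (permute π y) (hy.comp_equiv π)
  rw [permute_mul, this, hπ.2 y hy, permute_mul]

theorem inv_mem_absorbed {n : ℕ} {I : Set (Fin (2 ^ n))} {π : Equiv.Perm (Fin (2 ^ n))}
    (hπ : π ∈ absorbed I) : π⁻¹ ∈ absorbed I := by
  rw [mem_absorbed_iff] at *
  refine ⟨inv_mem_affineAut hπ.1, fun y hy => ?_⟩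
  have := hπ.2 _ (hy.comp_equiv π⁻¹)
  change scDec n I (permute π (permute π⁻¹ y)) = _ at this
  rw [permute_permute_inv] at this
  rw [this, permute_inv_permute]
  rfl

theorem IsTriangular.mem_absorbed {n : ℕ} {I : Set (Fin (2 ^ n))} {π : Equiv.Perm (Fin (2 ^ n))}
    (h : IsTriangular n π) (hπ : π ∈ affineAut I) : π ∈ absorbed I :=
  mem_absorbed_iff.2 ⟨hπ, fun _ hy =>
    (h.scDec_permute (fun _ hx => hπ.2 ▸ Set.mem_image_of_mem _ hx) (hy.noTie I)).2⟩

/-- The invertible matrices such that all affine permutations with this linear part are absorbed. -/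
def absorbedMatrices {n : ℕ} (I : Set (Fin (2 ^ n))) : Set (Matrix (Fin n) (Fin n) (ZMod 2)) :=
  {A | IsUnit A ∧ ∀ b π, IsAffineWith A b π → π ∈ absorbed I}

theorem isParabolic_absorbedMatrices {n : ℕ} {I : Set (Fin (2 ^ n))}
    (hI : ∀ (A : Matrix (Fin n) (Fin n) (ZMod 2)) b π, (∀ i j, i < j → A i j = 0) →
      (∀ i, A i i = 1) → IsAffineWith A b π → π ∈ affineAut I) :
    IsParabolic (absorbedMatrices I) where
  isUnit A hA := hA.1
  mul A hA B hB := by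
    refine ⟨hA.1.mul hB.1, fun b π h => ?_⟩
    obtain ⟨σ, hσ⟩ := exists_isAffineWith hA.1 b
    obtain ⟨τ, hτ⟩ := exists_isAffineWith hB.1 0
    have := hσ.mul hτ
    rw [mulVec_zero, zero_add] at this
    rw [h.perm_ext this]
    exact mul_mem_absorbed (hA.2 _ _ hσ) (hB.2 _ _ hτ)
  inv A hA := by
    refine ⟨isUnit_nonsing_inv_iff.2 hA.1, fun b π h => ?_⟩
    have := h.inv (isUnit_nonsing_inv_iff.2 hA.1)
    rw [nonsing_inv_nonsing_inv _ ((isUnit_iff_isUnit_det _).1 hA.1)] at this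
    simpa using inv_mem_absorbed (hA.2 _ _ this)
  lower A hA hA' := by
    refine ⟨?_, fun b π h => (isTriangular_of_isAffineWith hA hA' h).mem_absorbed
      (hI A b π hA hA' h)⟩
    rw [isUnit_iff_isUnit_det, det_of_isLowerTriangular _ fun i j hij => hA i j hij]
    simp [hA']

/-- Membership in the absorbed group depends on the linear part only, as translations are
absorbed. -/
theorem mem_absorbed_iff_exists_matrix {n : ℕ} {I : Set (Fin (2 ^ n))}
    (hI : ∀ (A : Matrix (Fin n) (Fin n) (ZMod 2)) b π, (∀ i j, i < j → A i j = 0) →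
      (∀ i, A i i = 1) → IsAffineWith A b π → π ∈ affineAut I) {π : Equiv.Perm (Fin (2 ^ n))} :
    π ∈ absorbed I ↔ ∃ A b, A ∈ absorbedMatrices I ∧ IsAffineWith A b π := by
  constructor
  · intro h
    obtain ⟨A, b, hA, hπ⟩ := h.1.1
    refine ⟨A, b, ⟨hA, fun b' σ hσ => ?_⟩, hπ⟩
    -- `σ` and `π` differ by a translation, which is triangular.
    obtain ⟨τ, hτ⟩ := exists_isAffineWith (n := n) isUnit_one (b' - b)
    have := hτ.mul hπ
    rw [one_mul, one_mulVec, add_sub_cancel] at this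
    rw [hσ.perm_ext this]
    exact mul_mem_absorbed (((isParabolic_absorbedMatrices hI).one_mem).2 _ _ hτ) h
  · rintro ⟨A, b, hA, hπ⟩
    exact hA.2 b π hπ

/-! ### Compositions and their boundaries -/

theorem index_lt_index_iff {n : ℕ} (S : Composition n) (i j : Fin n) :
    S.index i < S.index j ↔ ∃ k ∈ S.boundaries, (i : ℕ) < k ∧ k ≤ (j : ℕ) := by
  have hmem : ∀ k, k ∈ S.boundaries ↔ ∃ t, t ≤ S.length ∧ S.sizeUpTo t = k := by
    intro k
    simp only [Composition.boundaries, Finset.mem_map, Finset.mem_univ, true_and]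
    constructor
    · rintro ⟨t, rfl⟩
      exact ⟨t, Nat.lt_succ_iff.1 t.2, rfl⟩
    · rintro ⟨t, ht, h⟩
      exact ⟨⟨t, Nat.lt_succ_iff.2 ht⟩, Fin.ext h⟩
  constructor
  · intro h
    refine ⟨S.boundary (S.index j).castSucc, (hmem _).2 ⟨S.index j, (S.index j).2.le, rfl⟩, ?_,
      S.sizeUpTo_index_le j⟩
    exact (S.lt_sizeUpTo_index_succ i).trans_le (S.monotone_sizeUpTo h)
  · rintro ⟨k, hk, hik, hkj⟩
    obtain ⟨t, ht, htk⟩ := (hmem k).1 hk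
    rw [← htk] at hik hkj
    by_contra! hle
    have h1 : t ≤ S.index j := by
      by_contra! hlt
      have := S.monotone_sizeUpTo (Nat.succ_le_of_lt hlt)
      have := (S.lt_sizeUpTo_index_succ j).trans_le this
      omega
    have := S.monotone_sizeUpTo (h1.trans (Fin.le_def.1 hle))
    have := S.sizeUpTo_index_le i
    omega

/-- A list of positive numbers whose partial sums include those of `l` is obtained from `l` by
splitting its entries. -/
theorem exists_flatten_eq_of_partialSums (l : List ℕ) : ∀ m : List ℕ, (∀ a ∈ m, 0 < a) →
    m.sum = l.sum → (∀ t ≤ l.length, ∃ s, (m.take s).sum = (l.take t).sum) →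
    ∃ L : List (List ℕ), m = L.flatten ∧ L.map List.sum = l := by
  induction l with
  | nil =>
    intro m hm hsum _
    refine ⟨[], ?_, rfl⟩
    rcases m with - | ⟨a, m⟩
    · rfl
    · have := hm a (by simp)
      simp at hsum
      omega
  | cons a l ih =>
    intro m hm hsum h
    obtain ⟨s, hs⟩ := h 1 (by simp)
    have hs' : (m.take s).sum = a := by simpa using hs
    have hdrop : a + (m.drop s).sum = m.sum := by rw [← hs', List.sum_take_add_sum_drop]
    obtain ⟨L, hL, hL'⟩ := ih (m.drop s) (fun x hx => hm x (List.mem_of_mem_drop hx))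
      (by simp at hsum; omega) (by
        intro t ht
        obtain ⟨r, hr⟩ := h (t + 1) (by simpa using ht)
        simp only [List.take_succ_cons, List.sum_cons] at hr
        rcases le_total s r with hsr | hsr
        · refine ⟨r - s, ?_⟩
          have : m.take r = m.take s ++ (m.drop s).take (r - s) := by
            rw [← List.take_add, Nat.add_sub_cancel' hsr]
          rw [this, List.sum_append] at hr
          omega
        · refine ⟨0, ?_⟩
          have : (m.take s).sum = (m.take r).sum + ((m.take s).drop r).sum := by
            conv_lhs => rw [← List.sum_take_add_sum_drop (m.take s) r]
            rw [List.take_take, min_eq_left hsr]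
          simp
          omega)
    exact ⟨m.take s :: L, by rw [List.flatten_cons, ← hL, List.take_append_drop],
      by rw [List.map_cons, hs', hL']⟩

theorem refines_of_boundaries_subset {n : ℕ} {S₁ S : Composition n}
    (h : S.boundaries ⊆ S₁.boundaries) : Refines S₁ S := by
  obtain ⟨L, hL, hL'⟩ := exists_flatten_eq_of_partialSums S.blocks S₁.blocks
    (fun _ => S₁.blocks_pos) (by rw [S₁.blocks_sum, S.blocks_sum]) (by
      intro t ht
      have hk : S.boundary ⟨t, Nat.lt_succ_iff.2 ht⟩ ∈ S₁.boundaries :=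
        h (Finset.mem_map_of_mem _ (Finset.mem_univ _))
      obtain ⟨s, -, hs⟩ := Finset.mem_map.1 hk
      exact ⟨s, congrArg Fin.val hs⟩)
  have hlen : L.length = S.length := by rw [← S.blocks_length, ← hL', List.length_map]
  refine ⟨fun i => ⟨L[i], fun {a} ha => ?_, ?_⟩, ?_⟩
  · refine S₁.blocks_pos (i := a) ?_
    rw [hL]
    exact List.mem_flatten_of_mem (List.getElem_mem _) ha
  · have : L[i].sum = (L.map List.sum)[i]'(by simp [hlen]) := by simp
    exact this.trans (List.getElem_of_eq hL' _)
  · refine hL.trans (congrArg List.flatten ?_)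
    refine List.ext_getElem (by simp [hlen]) fun i h1 h2 => by simp

theorem exists_composition_boundaries {n : ℕ} (K : Set (Fin (n + 1))) (h0 : 0 ∈ K)
    (hn : Fin.last n ∈ K) : ∃ S : Composition n, ∀ k, k ∈ S.boundaries ↔ k ∈ K := by
  classical
  exact ⟨(CompositionAsSet.mk (Finset.univ.filter (· ∈ K)) (by simpa) (by simpa)).toComposition,
    fun k => by rw [CompositionAsSet.toComposition_boundaries]; simp⟩

end PolarSC

theorem mainTheorem4 (n : ℕ) (I : Set (Fin (2 ^ n))) (S : Composition n)
    (hS : PolarSC.affineAut I = PolarSC.BLTA S) :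
    ∃ S₁ : Composition n, PolarSC.Refines S₁ S ∧ PolarSC.absorbed I = PolarSC.BLTA S₁ := by
  have hI : ∀ (A : Matrix (Fin n) (Fin n) (ZMod 2)) b π, (∀ i j, i < j → A i j = 0) →
      (∀ i, A i i = 1) → PolarSC.IsAffineWith A b π → π ∈ PolarSC.affineAut I := by
    intro A b π hA hA' h
    rw [hS]
    refine ⟨A, b, ?_, fun i j hij => hA i j ?_, h⟩
    · rw [Matrix.isUnit_iff_isUnit_det, Matrix.det_of_isLowerTriangular _ fun i j hij => hA i j hij]
      simp [hA']
    · obtain ⟨k, -, hik, hkj⟩ := (PolarSC.index_lt_index_iff S i j).1 hij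
      exact Fin.lt_def.2 (lt_of_lt_of_le hik hkj)
  have hP := PolarSC.isParabolic_absorbedMatrices hI
  obtain ⟨S₁, hS₁⟩ := PolarSC.exists_composition_boundaries
    {k : Fin (n + 1) | PolarSC.IsCut (PolarSC.absorbedMatrices I) k}
    (fun _ _ _ _ hi _ => absurd hi (Nat.not_lt_zero _))
    (fun _ _ _ j _ hj => absurd j.2 (not_lt.2 hj))
  refine ⟨S₁, PolarSC.refines_of_boundaries_subset fun k hk => (hS₁ k).2 ?_, ?_⟩
  · intro A hA i j hi hj
    obtain ⟨π, hπ⟩ := PolarSC.exists_isAffineWith hA.1 0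
    have hπS : π ∈ PolarSC.BLTA S := hS ▸ (hA.2 0 π hπ).1
    obtain ⟨A', b', -, hA', hπ'⟩ := hπS
    rw [hπ.matrix_ext hπ']
    exact hA' i j ((PolarSC.index_lt_index_iff S i j).2 ⟨k, hk, hi, hj⟩)
  · ext π
    rw [PolarSC.mem_absorbed_iff_exists_matrix hI]
    refine exists_congr fun A => exists_congr fun b => ?_
    rw [hP.mem_iff, and_assoc]
    refine and_congr_right fun _ => and_congr_left fun _ => ⟨fun h i j hij => ?_,
      fun h k hk i j hi hj => ?_⟩
    · obtain ⟨k, hk, hi, hj⟩ := (PolarSC.index_lt_index_iff S₁ i j).1 hij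
      exact h k ((hS₁ k).1 hk) i j hi hj
    · exact h i j ((PolarSC.index_lt_index_iff S₁ i j).2
        ⟨⟨k, by omega⟩, (hS₁ _).2 hk, hi, hj⟩)
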